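/- Let $F$ be a field of characteristic $0$, let $A$ be a finite-dimensional central simple (associative, unital) $F$-algebra, let $\mathcal D$ be the (associative, not necessarily unital) subalgebra of $\operatorname{End}_F(A)$ generated by all inner derivations $x \mapsto ax-xa$, $a \in A$, of $A$, and let $[A,A]$ be the linear span of all commutators $xy-yx$ with $x,y\in A$. For every $T \in \operatorname{End}_F(A)$ the following statements are equivalent: (i) $T \in \mathcal D$; (ii) there exist finitely many $a_1,\dots,a_n, b_1,\dots,b_n \in A$ such that $Tx = \sum_{k} a_k x b_k$ for all $x \in A$, $\sum_k a_k b_k = 0$ and $\sum_k b_k a_k = 0$; (iii) $T(1)=0$ and $T(A) \subseteq [A,A]$. -/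

import Mathlib

/-- The (associative, not necessarily unital) subalgebra of `End_F(A)` generated by all inner
derivations `x ↦ a * x - x * a` of `A`. -/
def innerDerivationAlgebra (F A : Type*) [Field F] [Ring A] [Algebra F A] :
    NonUnitalSubalgebra F (Module.End F A) :=
  NonUnitalAlgebra.adjoin F
    (Set.range fun a : A => LinearMap.mulLeft F a - LinearMap.mulRight F a)

/-- The subspace `[A, A]`: the linear span of all commutators `x * y - y * x`. -/
def commutatorSubspace (F A : Type*) [Field F] [Ring A] [Algebra F A] : Submodule F A :=
  Submodule.span F {z : A | ∃ x y : A, z = x * y - y * x}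

/-!
Write `D` for the algebra generated by the inner derivations and `B x y z` for the class of
`ad x * L y * ad z` modulo `D`. Since `ad x * L y + ad y * L x` and `L x * ad y + L y * ad x` lie in
`D`, the trilinear map `B` is skew-symmetric. Contract it along the separability idempotent
`∑ i, e i ⊗ f i` coming from dual bases for the form `tr (L x * L y)`, setting
`s x y = ∑ i, B x (e i * y) (f i)`. Then `s` is skew, `B x y z = -s x ⁅y, z⁆`, and so every `ad y`
is self-adjoint for `s`. Hence `ad ⁅y, y'⁆` is at once self-adjoint and skew-adjoint, that is
`s ⁅⁅y, y'⁆, x⁆ z = 0`, which gives `B x ⁅y, y'⁆ z = 0`. As `B` also vanishes on the center, and `A`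
is spanned by the center and the commutators, `B = 0`.

It follows that `ad x * S * ad y` lies in `D` for all `x`, `y` and every linear `S`, because the
operators `z ↦ a * z * b` span `End A`. If `T 1 = 0` and `T` maps into `[A, A]`, then `T` is the sum
of the operators `ad (f i) * (L (e i) * T * L (e j)) * ad (f j)`, so it lies in `D`.
-/

open LieAlgebra (ad)
open LinearMap (mulLeft mulRight)
open scoped TensorProduct

section Separability

attribute [local instance] LieRing.ofAssociativeRing

variable {R A Q ι : Type*} [CommRing R] [Ring A] [Algebra R A] [AddCommGroup Q] [Module R Q]
  [Fintype ι]

/-- The tensor `∑ i, e i ⊗ f i` is a symmetric separability idempotent of the `R`-algebra `A`. -/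
structure IsSymmetricSeparability (R : Type*) {A ι : Type*} [CommRing R] [Ring A] [Algebra R A]
    [Fintype ι] (e f : ι → A) : Prop where
  swap : ∑ i, f i ⊗ₜ[R] e i = ∑ i, e i ⊗ₜ[R] f i
  mul_left (x : A) : ∑ i, (x * e i) ⊗ₜ[R] f i = ∑ i, e i ⊗ₜ[R] (f i * x)
  sum_mul : ∑ i, e i * f i = 1

theorem sum_apply_eq_of_sum_tmul_eq {e f e' f' : ι → A}
    (h : ∑ i, e i ⊗ₜ[R] f i = ∑ i, e' i ⊗ₜ[R] f' i) (β : A →ₗ[R] A →ₗ[R] Q) :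
    ∑ i, β (e i) (f i) = ∑ i, β (e' i) (f' i) := by
  simpa only [map_sum, TensorProduct.lift.tmul] using congrArg (TensorProduct.lift β) h

namespace IsSymmetricSeparability

variable {e f : ι → A} (h : IsSymmetricSeparability R e f)
include h

theorem sum_apply_swap (β : A →ₗ[R] A →ₗ[R] Q) :
    ∑ i, β (f i) (e i) = ∑ i, β (e i) (f i) :=
  sum_apply_eq_of_sum_tmul_eq h.swap β

theorem sum_apply_mul_left (β : A →ₗ[R] A →ₗ[R] Q) (x : A) :
    ∑ i, β (x * e i) (f i) = ∑ i, β (e i) (f i * x) :=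
  sum_apply_eq_of_sum_tmul_eq (h.mul_left x) β

theorem sum_apply_mul_right (β : A →ₗ[R] A →ₗ[R] Q) (x : A) :
    ∑ i, β (e i * x) (f i) = ∑ i, β (e i) (x * f i) :=
  calc ∑ i, β (e i * x) (f i)
    _ = ∑ i, β (f i * x) (e i) := (h.sum_apply_swap (β ∘ₗ mulRight R x)).symm
    _ = ∑ i, β (f i) (x * e i) := (h.sum_apply_mul_left β.flip x).symm
    _ = ∑ i, β (e i) (x * f i) := h.sum_apply_swap (β.compl₂ (mulLeft R x))

theorem sum_mul_mul_swap (x : A) : ∑ i, f i * x * e i = ∑ i, e i * x * f i :=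
  h.sum_apply_swap (LinearMap.mul R A ∘ₗ mulRight R x)

theorem sum_mul_mul_mem_center (x : A) : ∑ i, e i * x * f i ∈ Subalgebra.center R A := by
  refine Subalgebra.mem_center_iff.2 fun y => ?_
  have := h.sum_apply_mul_left (LinearMap.mul R A ∘ₗ mulRight R x) y
  simpa only [Finset.mul_sum, Finset.sum_mul, LinearMap.comp_apply, LinearMap.mulRight_apply,
    LinearMap.mul_apply', mul_assoc] using this

theorem sum_mul_swap : ∑ i, f i * e i = 1 := by
  simpa only [mul_one, h.sum_mul] using h.sum_mul_mul_swap 1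

theorem sum_mul_ad (x : A) : ∑ i, e i * ad R A (f i) x = x - ∑ i, e i * x * f i := by
  simp only [LieAlgebra.ad_apply, Ring.lie_def, mul_sub, Finset.sum_sub_distrib, ← mul_assoc,
    ← Finset.sum_mul, h.sum_mul, one_mul]

theorem sum_ad_mul (x : A) : ∑ i, ad R A (f i) (e i * x) = x - ∑ i, e i * x * f i := by
  simp only [LieAlgebra.ad_apply, Ring.lie_def, Finset.sum_sub_distrib, ← mul_assoc,
    ← Finset.sum_mul, h.sum_mul_swap, one_mul]

end IsSymmetricSeparability

/-- The contraction `β ↦ (y ↦ ∑ i, β (e i * y) (f i))` of bilinear maps along `∑ i, e i ⊗ f i`. -/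
def contraction (e f : ι → A) : (A →ₗ[R] A →ₗ[R] Q) →ₗ[R] A →ₗ[R] Q :=
  ∑ i, LinearMap.lcomp R Q (mulLeft R (e i)) ∘ₗ LinearMap.applyₗ (f i) ∘ₗ
    LinearMap.lflip.toLinearMap

theorem contraction_apply (e f : ι → A) (β : A →ₗ[R] A →ₗ[R] Q) (y : A) :
    contraction e f β y = ∑ i, β (e i * y) (f i) := by
  simp [contraction, LinearMap.sum_apply]

namespace IsSymmetricSeparability

variable {e f : ι → A} (h : IsSymmetricSeparability R e f) {β : A →ₗ[R] A →ₗ[R] Q}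
  (skew : ∀ x y, β x y = -β y x)
include h skew

theorem sum_apply_lie (y : A) : ∑ i, β ⁅e i, y⁆ (f i) = (2 : R) • contraction e f β y := by
  have hleft : ∑ i, β (y * e i) (f i) = -∑ i, β (e i * y) (f i) := by
    rw [h.sum_apply_mul_left, ← Finset.sum_neg_distrib]
    calc ∑ i, β (e i) (f i * y)
      _ = ∑ i, -β (f i * y) (e i) := by simp only [← skew]
      _ = ∑ i, -β (e i * y) (f i) := h.sum_apply_swap (-(β ∘ₗ mulRight R y))
  simp only [Ring.lie_def, map_sub, LinearMap.sub_apply, Finset.sum_sub_distrib, hleft,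
    contraction_apply, two_smul, sub_neg_eq_add]

theorem sum_apply_mul_mul (x y : A) :
    ∑ i, β (f i) (y * (e i * x)) = -∑ i, β (e i * x) (f i * y) :=
  calc ∑ i, β (f i) (y * (e i * x))
    _ = ∑ i, β (e i) (y * (f i * x)) :=
      h.sum_apply_swap (β.compl₂ (mulLeft R y ∘ₗ mulRight R x))
    _ = ∑ i, β (x * e i) (y * f i) :=
      (h.sum_apply_mul_left (β.compl₂ (mulLeft R y)) x).symm
    _ = ∑ i, β (x * (e i * y)) (f i) := (h.sum_apply_mul_right (β ∘ₗ mulLeft R x) y).symm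
    _ = ∑ i, -β (f i) (x * (e i * y)) := by simp only [← skew]
    _ = ∑ i, -β (e i) (x * (f i * y)) :=
      h.sum_apply_swap (-β.compl₂ (mulLeft R x ∘ₗ mulRight R y))
    _ = -∑ i, β (e i) (x * (f i * y)) := Finset.sum_neg_distrib _
    _ = -∑ i, β (e i * x) (f i * y) := by
      simpa only [LinearMap.compl₂_apply, LinearMap.mulRight_apply, mul_assoc] using
        congrArg Neg.neg (h.sum_apply_mul_right (β.compl₂ (mulRight R y)) x).symm

/-- Substituting `∑ i, e i * x ⊗ f i` in `jordan` makes all but two of the terms on the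
right cancel; on the left it averages one argument into the center. -/
theorem contraction_lie (hcenter : ∀ z ∈ Subalgebra.center R A, β z = 0)
    (jordan : ∀ x y w, β (x * y + y * x) w = β x (y * w + w * y) + β y (x * w + w * x))
    (x y : A) : contraction e f β ⁅x, y⁆ = -β x y := by
  have hleft : ∑ i, β (e i * x * f i + f i * (e i * x)) y = β x y := by
    simp only [map_add, LinearMap.add_apply, Finset.sum_add_distrib, ← mul_assoc]
    simp only [← LinearMap.sum_apply, ← map_sum, hcenter _ (h.sum_mul_mul_mem_center x),
      ← Finset.sum_mul, h.sum_mul_swap, one_mul, LinearMap.zero_apply, zero_add]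
  have hyx : ∑ i, β (e i * x) (y * f i) = contraction e f β (y * x) := by
    rw [contraction_apply]
    simpa only [LinearMap.comp_apply, LinearMap.mulRight_apply, mul_assoc] using
      (h.sum_apply_mul_right (β ∘ₗ mulRight R x) y).symm
  have hxy : ∑ i, β (f i) (e i * x * y) = -contraction e f β (x * y) := by
    simp only [contraction_apply, ← Finset.sum_neg_distrib, ← skew, mul_assoc]
  rw [← hleft, eq_neg_iff_add_eq_zero]
  simp only [jordan]
  simp only [map_add, Finset.sum_add_distrib]
  rw [h.sum_apply_mul_mul skew, hyx, hxy, Ring.lie_def, map_sub]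
  abel

end IsSymmetricSeparability

/-- By invariance `ad y` and `ad y'` are self-adjoint, so their commutator `ad ⁅y, y'⁆` is both
skew-adjoint and self-adjoint. -/
theorem two_smul_apply_lie_lie_eq_zero {L : Type*} [LieRing L] [LieAlgebra R L]
    {s : L →ₗ[R] L →ₗ[R] Q} (hs : ∀ y x z : L, s ⁅y, x⁆ z = s x ⁅y, z⁆) (y y' x z : L) :
    (2 : R) • s ⁅⁅y, y'⁆, x⁆ z = 0 := by
  have hskew : s ⁅⁅y, y'⁆, x⁆ z = -s x ⁅⁅y, y'⁆, z⁆ := by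
    simp only [lie_lie, map_sub, LinearMap.sub_apply, hs, neg_sub]
  rw [two_smul]
  nth_rw 1 [hskew]
  rw [hs, neg_add_cancel]

end Separability

section InnerDerivations

attribute [local instance] LieRing.ofAssociativeRing

variable {F A : Type*} [Field F] [Ring A] [Algebra F A]

theorem ad_mem_innerDerivationAlgebra (x : A) : ad F A x ∈ innerDerivationAlgebra F A :=
  NonUnitalAlgebra.subset_adjoin F ⟨x, by rw [LieAlgebra.ad_eq_lmul_left_sub_lmul_right]; rfl⟩

theorem ad_mul_mem_innerDerivationAlgebra (x : A) {T : Module.End F A}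
    (hT : T ∈ innerDerivationAlgebra F A) : ad F A x * T ∈ innerDerivationAlgebra F A :=
  mul_mem (ad_mem_innerDerivationAlgebra x) hT

theorem mul_ad_mem_innerDerivationAlgebra {T : Module.End F A}
    (hT : T ∈ innerDerivationAlgebra F A) (x : A) : T * ad F A x ∈ innerDerivationAlgebra F A :=
  mul_mem hT (ad_mem_innerDerivationAlgebra x)

theorem ad_mul_mulLeft_add_swap_mem (x y : A) :
    ad F A x * mulLeft F y + ad F A y * mulLeft F x ∈ innerDerivationAlgebra F A := by
  have key : ad F A x * mulLeft F y + ad F A y * mulLeft F x =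
      ad F A (x * y) + ad F A y * ad F A x := by
    ext a
    simp only [LinearMap.add_apply, Module.End.mul_apply, LieAlgebra.ad_apply, Ring.lie_def,
      LinearMap.mulLeft_apply]
    noncomm_ring
  rw [key]
  exact add_mem (ad_mem_innerDerivationAlgebra _)
    (ad_mul_mem_innerDerivationAlgebra _ (ad_mem_innerDerivationAlgebra _))

theorem mulLeft_mul_ad_add_swap_mem (x y : A) :
    mulLeft F x * ad F A y + mulLeft F y * ad F A x ∈ innerDerivationAlgebra F A := by
  have key : mulLeft F x * ad F A y + mulLeft F y * ad F A x =
      ad F A (x * y) + ad F A y * ad F A x := by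
    ext a
    simp only [LinearMap.add_apply, Module.End.mul_apply, LieAlgebra.ad_apply, Ring.lie_def,
      LinearMap.mulLeft_apply]
    noncomm_ring
  rw [key]
  exact add_mem (ad_mem_innerDerivationAlgebra _)
    (ad_mul_mem_innerDerivationAlgebra _ (ad_mem_innerDerivationAlgebra _))

variable (F A) in
/-- The class of `ad x * L y * ad z` modulo the algebra generated by the inner derivations, where
`L y` is left multiplication by `y`; it measures the failure of that operator to lie in the
algebra. -/
def sandwichClass : A →ₗ[F] A →ₗ[F] A →ₗ[F]
    Module.End F A ⧸ (innerDerivationAlgebra F A).toSubmodule :=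
  let adLin : A →ₗ[F] Module.End F A := ad F A
  let adMulLeft : A →ₗ[F] A →ₗ[F] Module.End F A :=
    (LinearMap.mul F (Module.End F A)).compl₁₂ adLin (LinearMap.mul F A)
  adMulLeft.compr₂ <|
    (Submodule.mkQ (innerDerivationAlgebra F A).toSubmodule).compRight F ∘ₗ
      LinearMap.lcomp F (Module.End F A) adLin ∘ₗ LinearMap.mul F (Module.End F A)

theorem sandwichClass_apply (x y z : A) :
    sandwichClass F A x y z =
      (innerDerivationAlgebra F A).toSubmodule.mkQ (ad F A x * mulLeft F y * ad F A z) :=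
  rfl

theorem sandwichClass_eq_zero_iff {x y z : A} : sandwichClass F A x y z = 0 ↔
    ad F A x * mulLeft F y * ad F A z ∈ innerDerivationAlgebra F A := by
  rw [sandwichClass_apply, Submodule.mkQ_apply, Submodule.Quotient.mk_eq_zero,
    NonUnitalSubalgebra.mem_toSubmodule]

theorem sandwichClass_swap_left (x y z : A) :
    sandwichClass F A x y z = -sandwichClass F A y x z := by
  rw [eq_neg_iff_add_eq_zero, sandwichClass_apply, sandwichClass_apply, ← map_add,
    Submodule.mkQ_apply, Submodule.Quotient.mk_eq_zero, ← add_mul]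
  exact mul_ad_mem_innerDerivationAlgebra (ad_mul_mulLeft_add_swap_mem x y) z

theorem sandwichClass_swap_right (x y z : A) :
    sandwichClass F A x y z = -sandwichClass F A x z y := by
  rw [eq_neg_iff_add_eq_zero, sandwichClass_apply, sandwichClass_apply, ← map_add,
    Submodule.mkQ_apply, Submodule.Quotient.mk_eq_zero, mul_assoc, mul_assoc, ← mul_add]
  exact ad_mul_mem_innerDerivationAlgebra x (mulLeft_mul_ad_add_swap_mem y z)

theorem sandwichClass_cyclic (x y z : A) : sandwichClass F A x y z = sandwichClass F A y z x := by
  rw [sandwichClass_swap_left, sandwichClass_swap_right, neg_neg]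

theorem ad_mul_mulLeft_mul_ad_add_swap_mem (x y z : A) :
    ad F A x * mulLeft F y * ad F A z + ad F A z * mulLeft F y * ad F A x ∈
      innerDerivationAlgebra F A := by
  have hswap : sandwichClass F A x y z + sandwichClass F A z y x = 0 := by
    rw [sandwichClass_cyclic, sandwichClass_swap_left, neg_add_cancel]
  rwa [sandwichClass_apply, sandwichClass_apply, ← map_add, Submodule.mkQ_apply,
    Submodule.Quotient.mk_eq_zero] at hswap

theorem sandwichClass_mul_add_mul (x y w z : A) :
    sandwichClass F A (x * y + y * x) w z =
      sandwichClass F A x (y * w + w * y) z + sandwichClass F A y (x * w + w * x) z := by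
  have key : ad F A (x * y + y * x) * mulLeft F w * ad F A z -
      (ad F A x * mulLeft F (y * w + w * y) * ad F A z +
        ad F A y * mulLeft F (x * w + w * x) * ad F A z) =
      -((ad F A x * mulLeft F w * ad F A y + ad F A y * mulLeft F w * ad F A x) * ad F A z) := by
    ext a
    simp only [LinearMap.add_apply, LinearMap.sub_apply, LinearMap.neg_apply,
      Module.End.mul_apply, LieAlgebra.ad_apply, Ring.lie_def, LinearMap.mulLeft_apply]
    noncomm_ring
  simp only [sandwichClass_apply, ← map_add]
  rw [← sub_eq_zero, ← map_sub, Submodule.mkQ_apply, Submodule.Quotient.mk_eq_zero, key]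
  exact neg_mem (mul_ad_mem_innerDerivationAlgebra (ad_mul_mulLeft_mul_ad_add_swap_mem x w y) z)

/-- Commuting `ad w` past `L y` compares `ad x * (ad w * L y * ad z)` with
`(ad x * L y * ad w) * ad z`. Symmetrizing in `w, z` and in `x, y` moves both of them into the
algebra, and only the commutator terms survive. -/
theorem sandwichClass_lie (x y w z : A) :
    sandwichClass F A x ⁅w, y⁆ z + sandwichClass F A x ⁅z, y⁆ w +
      sandwichClass F A y ⁅w, x⁆ z + sandwichClass F A y ⁅z, x⁆ w = 0 := by
  have key : ad F A x * mulLeft F ⁅w, y⁆ * ad F A z + ad F A x * mulLeft F ⁅z, y⁆ * ad F A w +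
      ad F A y * mulLeft F ⁅w, x⁆ * ad F A z + ad F A y * mulLeft F ⁅z, x⁆ * ad F A w =
      ad F A x * (ad F A w * mulLeft F y * ad F A z + ad F A z * mulLeft F y * ad F A w) +
      ad F A y * (ad F A w * mulLeft F x * ad F A z + ad F A z * mulLeft F x * ad F A w) -
      (ad F A x * mulLeft F y + ad F A y * mulLeft F x) * ad F A w * ad F A z -
      (ad F A x * mulLeft F y + ad F A y * mulLeft F x) * ad F A z * ad F A w := by
    have comm (u v : A) : mulLeft F ⁅u, v⁆ = ad F A u * mulLeft F v - mulLeft F v * ad F A u := by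
      ext a
      simp only [LinearMap.sub_apply, Module.End.mul_apply, LieAlgebra.ad_apply, Ring.lie_def,
        LinearMap.mulLeft_apply]
      noncomm_ring
    simp only [comm]
    noncomm_ring
  simp only [sandwichClass_apply, ← map_add]
  rw [Submodule.mkQ_apply, Submodule.Quotient.mk_eq_zero, key]
  have left (u v : A) := ad_mul_mem_innerDerivationAlgebra u
    (ad_mul_mulLeft_mul_ad_add_swap_mem (F := F) w v z)
  have right (u v : A) := mul_ad_mem_innerDerivationAlgebra
    (mul_ad_mem_innerDerivationAlgebra (ad_mul_mulLeft_add_swap_mem (F := F) x y) u) v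
  exact sub_mem (sub_mem (add_mem (left x y) (left y x)) (right w z)) (right z w)

theorem sandwichClass_eq_zero_of_mem_center {x : A} (hx : x ∈ Subalgebra.center F A) :
    sandwichClass F A x = 0 := by
  have had : ad F A x = 0 := by
    ext a
    rw [LieAlgebra.ad_apply, Ring.lie_def, Subalgebra.mem_center_iff.1 hx a, sub_self,
      LinearMap.zero_apply]
  ext y z : 2
  rw [sandwichClass_apply, had, zero_mul, zero_mul, map_zero, LinearMap.zero_apply,
    LinearMap.zero_apply]

end InnerDerivations

section SeparableAlgebra

attribute [local instance] LieRing.ofAssociativeRing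

variable {F A ι : Type*} [Field F] [Ring A] [Algebra F A] [Fintype ι] {e f : ι → A}

namespace IsSymmetricSeparability

variable (h : IsSymmetricSeparability F e f)
include h

theorem contraction_sandwichClass_apply_lie (x y z : A) :
    contraction e f (sandwichClass F A x) ⁅y, z⁆ = -sandwichClass F A x y z := by
  refine h.contraction_lie (sandwichClass_swap_right x) (fun c hc => ?_)
    (fun u v w => ?_) y z
  · ext w
    rw [sandwichClass_cyclic, sandwichClass_eq_zero_of_mem_center hc]
    simp only [LinearMap.zero_apply]
  · simp only [sandwichClass_cyclic x, sandwichClass_mul_add_mul]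

variable (h2 : (2 : F) ≠ 0)
include h2

theorem contraction_sandwichClass_swap (x y : A) :
    contraction e f (sandwichClass F A x) y = -contraction e f (sandwichClass F A y) x := by
  have hlie (u v : A) : ∑ i, sandwichClass F A u ⁅e i, v⁆ (f i) =
      (2 : F) • contraction e f (sandwichClass F A u) v :=
    h.sum_apply_lie (sandwichClass_swap_right u) v
  have hlie_swap (u v : A) : ∑ i, sandwichClass F A u ⁅f i, v⁆ (e i) =
      (2 : F) • contraction e f (sandwichClass F A u) v := by
    rw [← hlie]
    exact h.sum_apply_swap (sandwichClass F A u ∘ₗ (mulRight F v - mulLeft F v))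
  have hsum : (4 : F) • (contraction e f (sandwichClass F A x) y +
      contraction e f (sandwichClass F A y) x) = 0 := by
    have := Finset.sum_eq_zero fun i (_ : i ∈ Finset.univ) =>
      sandwichClass_lie (F := F) x y (e i) (f i)
    simp only [Finset.sum_add_distrib, hlie, hlie_swap] at this
    rw [← this]
    module
  have h4 : (4 : F) ≠ 0 := by simpa only [two_mul, two_add_two_eq_four] using mul_ne_zero h2 h2
  exact eq_neg_of_add_eq_zero_left ((smul_eq_zero.1 hsum).resolve_left h4)

theorem contraction_sandwichClass_lie (x y z : A) :
    contraction e f (sandwichClass F A ⁅x, y⁆) z =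
      contraction e f (sandwichClass F A y) ⁅x, z⁆ := by
  rw [h.contraction_sandwichClass_swap h2, h.contraction_sandwichClass_apply_lie,
    h.contraction_sandwichClass_apply_lie, sandwichClass_cyclic, sandwichClass_swap_left, neg_neg]

theorem sandwichClass_lie_eq_zero (x y y' z : A) : sandwichClass F A x ⁅y, y'⁆ z = 0 := by
  have hzero := two_smul_apply_lie_lie_eq_zero (s := contraction e f ∘ₗ sandwichClass F A)
    (h.contraction_sandwichClass_lie h2) y y' z x
  rw [← neg_eq_zero, ← h.contraction_sandwichClass_apply_lie,
    h.contraction_sandwichClass_swap h2, neg_eq_zero]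
  exact (smul_eq_zero.1 hzero).resolve_left h2

theorem ad_mul_mulLeft_mul_ad_mem (x y z : A) :
    ad F A x * mulLeft F y * ad F A z ∈ innerDerivationAlgebra F A := by
  have hy : y = ∑ i, e i * y * f i + ∑ i, ⁅f i, e i * y⁆ :=
    eq_add_of_sub_eq' (h.sum_ad_mul y).symm
  have hcenter : sandwichClass F A x (∑ i, e i * y * f i) z = 0 := by
    rw [sandwichClass_cyclic, sandwichClass_eq_zero_of_mem_center (h.sum_mul_mul_mem_center y),
      LinearMap.zero_apply, LinearMap.zero_apply]
  rw [← sandwichClass_eq_zero_iff, hy, map_add, LinearMap.add_apply, hcenter, zero_add, map_sum,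
    LinearMap.sum_apply]
  exact Finset.sum_eq_zero fun i _ => h.sandwichClass_lie_eq_zero h2 _ _ _ _

theorem ad_mul_mulLeft_mul_mulRight_mul_ad_mem (w x y z : A) :
    ad F A w * (mulLeft F x * mulRight F y) * ad F A z ∈ innerDerivationAlgebra F A := by
  have key : ad F A w * (mulLeft F x * mulRight F y) * ad F A z =
      ad F A w * mulLeft F (x * y) * ad F A z -
        ad F A w * mulLeft F x * ad F A y * ad F A z := by
    have hR : mulRight F y = mulLeft F y - ad F A y := by
      rw [LieAlgebra.ad_eq_lmul_left_sub_lmul_right]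
      exact (sub_sub_cancel _ _).symm
    rw [hR, LinearMap.mulLeft_mul, ← Module.End.mul_eq_comp]
    noncomm_ring
  rw [key]
  exact sub_mem (h.ad_mul_mulLeft_mul_ad_mem h2 _ _ _)
    (mul_ad_mem_innerDerivationAlgebra (h.ad_mul_mulLeft_mul_ad_mem h2 _ _ _) _)

end IsSymmetricSeparability

end SeparableAlgebra

section RegularTrace

variable {F A : Type*} [Field F] [Ring A] [Algebra F A]

variable (F A) in
/-- The trace of left multiplication on `A`; `Algebra.trace` is only available over commutative
`A`. -/
noncomputable def regularTrace : A →ₗ[F] F :=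
  LinearMap.trace F A ∘ₗ LinearMap.mul F A

theorem regularTrace_mul_comm (x y : A) : regularTrace F A (x * y) = regularTrace F A (y * x) := by
  have hmul (x y : A) :
      regularTrace F A (x * y) = LinearMap.trace F A (mulLeft F x * mulLeft F y) := by
    rw [Module.End.mul_eq_comp, ← LinearMap.mulLeft_mul]
    rfl
  rw [hmul, hmul, LinearMap.trace_mul_comm]

theorem regularTrace_one [FiniteDimensional F A] :
    regularTrace F A 1 = (Module.finrank F A : F) := by
  rw [← LinearMap.trace_one, regularTrace, LinearMap.comp_apply]
  congr 1
  ext x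
  exact one_mul x

theorem regularTrace_eq_zero_of_mem_commutatorSubspace {x : A}
    (hx : x ∈ commutatorSubspace F A) : regularTrace F A x = 0 := by
  suffices commutatorSubspace F A ≤ LinearMap.ker (regularTrace F A) from this hx
  refine Submodule.span_le.2 ?_
  rintro _ ⟨x, y, rfl⟩
  rw [SetLike.mem_coe, LinearMap.mem_ker, map_sub, regularTrace_mul_comm, sub_self]

variable [FiniteDimensional F A]

theorem eq_zero_of_forall_regularTrace_mul_eq_zero [IsSimpleRing A]
    (hn : (Module.finrank F A : F) ≠ 0) {x : A} (hx : ∀ y, regularTrace F A (x * y) = 0) :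
    x = 0 := by
  by_contra hx0
  let radical : TwoSidedIdeal A := .mk' {x | ∀ y, regularTrace F A (x * y) = 0}
    (fun y => by rw [zero_mul, map_zero])
    (fun {a b} ha hb y => by rw [add_mul, map_add, ha, hb, add_zero])
    (fun {a} ha y => by rw [neg_mul, map_neg, ha, neg_zero])
    (fun {a b} hb y => by rw [mul_assoc, regularTrace_mul_comm, mul_assoc, hb])
    (fun {a b} ha y => by rw [mul_assoc, ha])
  have hone : (1 : A) ∈ radical :=
    IsSimpleRing.one_mem_of_ne_zero_mem radical hx0 ((TwoSidedIdeal.mem_mk' ..).2 hx)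
  apply hn
  rw [← regularTrace_one, ← mul_one (1 : A)]
  exact (TwoSidedIdeal.mem_mk' ..).1 hone 1

namespace IsSymmetricSeparability

variable {ι : Type*} [Fintype ι] {e f : ι → A} (h : IsSymmetricSeparability F e f)
include h

theorem finrank_smul_sum_mul_mul [Algebra.IsCentral F A] (x : A) :
    (Module.finrank F A : F) • ∑ i, e i * x * f i = algebraMap F A (regularTrace F A x) := by
  obtain ⟨c, hc⟩ := (Algebra.IsCentral.mem_center_iff F).1 (h.sum_mul_mul_mem_center x)
  have htrace : regularTrace F A (∑ i, e i * x * f i) = regularTrace F A x := by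
    simp only [map_sum, mul_assoc, regularTrace_mul_comm (e _)]
    rw [← map_sum]
    simp only [← Finset.mul_sum, h.sum_mul_swap, mul_one]
  rw [← htrace, hc, Algebra.algebraMap_eq_smul_one, map_smul, regularTrace_one, smul_smul,
    smul_eq_mul, mul_comm, Algebra.algebraMap_eq_smul_one]

theorem exists_apply_eq_sum_mul_mul [Algebra.IsCentral F A]
    (hdual : ∀ x, ∑ i, regularTrace F A (x * e i) • f i = x) (T : Module.End F A) :
    ∃ (n : ℕ) (a b : Fin n → A), ∀ x, T x = ∑ k, a k * x * b k := by
  let E := (Fintype.equivFin (ι × ι)).symm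
  refine ⟨_, fun k => (Module.finrank F A : F) • e (E k).2,
    fun k => e (E k).1 * f (E k).2 * T (f (E k).1), fun x => ?_⟩
  rw [E.sum_comp fun k => (Module.finrank F A : F) • e k.2 * x * (e k.1 * f k.2 * T (f k.1)),
    Fintype.sum_prod_type]
  calc T x
    _ = ∑ j, algebraMap F A (regularTrace F A (x * e j)) * T (f j) := by
      simp only [← Algebra.smul_def, ← map_smul, ← map_sum, hdual]
    _ = ∑ j, (Module.finrank F A : F) • (∑ i, e i * (x * e j) * f i) * T (f j) := by
      simp only [h.finrank_smul_sum_mul_mul]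
    _ = _ := by
      simp only [Finset.smul_sum, Finset.sum_mul, smul_mul_assoc, mul_assoc]

end IsSymmetricSeparability

section CentralSimple

variable [IsSimpleRing A] (hn : (Module.finrank F A : F) ≠ 0)
include hn

theorem exists_regularTrace_dual_families :
    ∃ e f : Fin (Module.finrank F A) → A,
      (∀ x, ∑ i, regularTrace F A (x * e i) • f i = x) ∧
      (∀ x, ∑ i, regularTrace F A (x * f i) • e i = x) ∧
      ∀ x, regularTrace F A x = ∑ i, regularTrace F A (x * e i * f i) := by
  classical
  let form : LinearMap.BilinForm F A := (LinearMap.mul F A).compr₂ (regularTrace F A)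
  have hsymm : form.IsSymm := ⟨regularTrace_mul_comm⟩
  have hform : form.Nondegenerate :=
    .ofSeparatingLeft fun x hx => eq_zero_of_forall_regularTrace_mul_eq_zero hn hx
  let e := Module.finBasis F A
  let f := form.dualBasis hform e
  have hf (x : A) (i) : f.repr x i = regularTrace F A (x * e i) :=
    LinearMap.BilinForm.dualBasis_repr_apply hform e x i
  have he (x : A) (i) : e.repr x i = regularTrace F A (x * f i) := by
    rw [← LinearMap.BilinForm.dualBasis_dualBasis hform hsymm e]
    exact LinearMap.BilinForm.dualBasis_repr_apply hform f x i
  refine ⟨e, f, fun x => ?_, fun x => ?_, fun x => ?_⟩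
  · simpa only [hf] using f.sum_repr x
  · simpa only [he] using e.sum_repr x
  · rw [regularTrace, LinearMap.comp_apply, LinearMap.trace_eq_matrix_trace F e]
    simp only [Matrix.trace, Matrix.diag, LinearMap.toMatrix_apply, he]
    rfl

theorem exists_isSymmetricSeparability_regularTrace_dual :
    ∃ e f : Fin (Module.finrank F A) → A, IsSymmetricSeparability F e f ∧
      ∀ x, ∑ i, regularTrace F A (x * e i) • f i = x := by
  obtain ⟨e, f, he, hf, htrace⟩ := exists_regularTrace_dual_families hn
  refine ⟨e, f, ⟨?_, fun x => ?_, ?_⟩, he⟩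
  · calc ∑ i, f i ⊗ₜ[F] e i
      _ = ∑ i, f i ⊗ₜ[F] ∑ j, regularTrace F A (e i * e j) • f j := by simp only [he]
      _ = ∑ j, (∑ i, regularTrace F A (e j * e i) • f i) ⊗ₜ[F] f j := by
        simp only [TensorProduct.tmul_sum, TensorProduct.sum_tmul, TensorProduct.tmul_smul,
          TensorProduct.smul_tmul']
        rw [Finset.sum_comm]
        simp only [regularTrace_mul_comm (e _) (e _)]
      _ = ∑ j, e j ⊗ₜ[F] f j := by simp only [he]
  · calc ∑ i, (x * e i) ⊗ₜ[F] f i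
      _ = ∑ i, (∑ j, regularTrace F A (x * e i * f j) • e j) ⊗ₜ[F] f i := by simp only [hf]
      _ = ∑ j, e j ⊗ₜ[F] ∑ i, regularTrace F A (f j * x * e i) • f i := by
        simp only [TensorProduct.tmul_sum, TensorProduct.sum_tmul, TensorProduct.tmul_smul,
          TensorProduct.smul_tmul']
        rw [Finset.sum_comm]
        simp only [regularTrace_mul_comm (f _), mul_assoc]
      _ = ∑ j, e j ⊗ₜ[F] (f j * x) := by simp only [he]
  · refine sub_eq_zero.1 (eq_zero_of_forall_regularTrace_mul_eq_zero hn fun x => ?_)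
    rw [regularTrace_mul_comm, mul_sub, mul_one, map_sub, htrace x, Finset.mul_sum, map_sum]
    simp only [mul_assoc, sub_self]

end CentralSimple

end RegularTrace

section Characterization

variable {F A : Type*} [Field F] [Ring A] [Algebra F A]

theorem apply_one_and_apply_mem_of_mem_innerDerivationAlgebra {T : Module.End F A}
    (hT : T ∈ innerDerivationAlgebra F A) : T 1 = 0 ∧ ∀ x, T x ∈ commutatorSubspace F A := by
  unfold innerDerivationAlgebra at hT
  induction hT using NonUnitalAlgebra.adjoin_induction with
  | mem T hT =>
    obtain ⟨a, rfl⟩ := hT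
    refine ⟨?_, fun x => Submodule.subset_span ⟨a, x, rfl⟩⟩
    rw [LinearMap.sub_apply, LinearMap.mulLeft_apply, LinearMap.mulRight_apply, mul_one, one_mul,
      sub_self]
  | zero => exact ⟨rfl, fun _ => zero_mem _⟩
  | add S T _ _ hS hT =>
    exact ⟨by rw [LinearMap.add_apply, hS.1, hT.1, add_zero], fun x => add_mem (hS.2 x) (hT.2 x)⟩
  | mul S T _ _ hS hT =>
    exact ⟨by rw [Module.End.mul_apply, hT.1, map_zero], fun x => hS.2 (T x)⟩
  | smul r T _ hT =>
    exact ⟨by rw [LinearMap.smul_apply, hT.1, smul_zero], fun x => Submodule.smul_mem _ r (hT.2 x)⟩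

theorem apply_one_and_apply_mem_of_apply_eq_sum {ι : Type*} [Fintype ι] {T : Module.End F A}
    {a b : ι → A} (hT : ∀ x, T x = ∑ k, a k * x * b k) (hab : ∑ k, a k * b k = 0)
    (hba : ∑ k, b k * a k = 0) : T 1 = 0 ∧ ∀ x, T x ∈ commutatorSubspace F A := by
  refine ⟨by simpa only [hT, mul_one] using hab, fun x => ?_⟩
  have hlie : T x = ∑ k, (a k * x * b k - b k * (a k * x)) := by
    simp only [hT, Finset.sum_sub_distrib, ← mul_assoc, ← Finset.sum_mul, hba, zero_mul, sub_zero]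
  rw [hlie]
  exact sum_mem fun k _ => Submodule.subset_span ⟨a k * x, b k, rfl⟩

variable [FiniteDimensional F A] [IsSimpleRing A] (hn : (Module.finrank F A : F) ≠ 0)
include hn

theorem sum_mul_eq_zero_of_apply_eq_sum {ι : Type*} [Fintype ι] {T : Module.End F A} {a b : ι → A}
    (hT : ∀ x, T x = ∑ k, a k * x * b k) (htrace : ∀ x, regularTrace F A (T x) = 0) :
    ∑ k, b k * a k = 0 := by
  refine eq_zero_of_forall_regularTrace_mul_eq_zero hn fun x => ?_
  calc regularTrace F A ((∑ k, b k * a k) * x)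
    _ = ∑ k, regularTrace F A (b k * (a k * x)) := by
      simp only [Finset.sum_mul, map_sum, mul_assoc]
    _ = regularTrace F A (T x) := by
      simp only [regularTrace_mul_comm (b _), hT, map_sum]
    _ = 0 := htrace x

variable [Algebra.IsCentral F A]

theorem exists_apply_eq_sum_of_apply_mem {T : Module.End F A} (h1 : T 1 = 0)
    (hT : ∀ x, T x ∈ commutatorSubspace F A) :
    ∃ (n : ℕ) (a b : Fin n → A), (∀ x, T x = ∑ k, a k * x * b k) ∧
      ∑ k, a k * b k = 0 ∧ ∑ k, b k * a k = 0 := by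
  obtain ⟨e, f, h, hdual⟩ := exists_isSymmetricSeparability_regularTrace_dual hn
  obtain ⟨n, a, b, hab⟩ := h.exists_apply_eq_sum_mul_mul hdual T
  refine ⟨n, a, b, hab, ?_, sum_mul_eq_zero_of_apply_eq_sum hn hab fun x =>
    regularTrace_eq_zero_of_mem_commutatorSubspace (hT x)⟩
  simpa only [mul_one, h1] using (hab 1).symm

attribute [local instance] LieRing.ofAssociativeRing

omit [IsSimpleRing A] in
theorem IsSymmetricSeparability.eq_sum_ad_mul_mul_ad {ι : Type*} [Fintype ι] {e f : ι → A}
    (h : IsSymmetricSeparability F e f) {T : Module.End F A} (h1 : T 1 = 0)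
    (htrace : ∀ x, regularTrace F A (T x) = 0) :
    T = ∑ i, ∑ j, ad F A (f i) * (mulLeft F (e i) * T * mulLeft F (e j)) * ad F A (f j) := by
  have hright (x : A) : T (∑ j, e j * ad F A (f j) x) = T x := by
    obtain ⟨c, hc⟩ := (Algebra.IsCentral.mem_center_iff F).1 (h.sum_mul_mul_mem_center x)
    rw [h.sum_mul_ad, hc, map_sub, Algebra.algebraMap_eq_smul_one, map_smul, h1, smul_zero,
      sub_zero]
  have hleft (x : A) : ∑ i, ad F A (f i) (e i * T x) = T x := by
    have hzero : ∑ i, e i * T x * f i = 0 := by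
      refine (smul_eq_zero.1 ?_).resolve_left hn
      rw [h.finrank_smul_sum_mul_mul, htrace, map_zero]
    rw [h.sum_ad_mul, hzero, sub_zero]
  ext x
  calc T x
    _ = ∑ i, ad F A (f i) (e i * T (∑ j, e j * ad F A (f j) x)) := by rw [hright, hleft]
    _ = _ := by
      simp only [map_sum, Finset.mul_sum, LinearMap.sum_apply, Module.End.mul_apply,
        LinearMap.mulLeft_apply]

theorem ad_mul_mul_ad_mem (h2 : (2 : F) ≠ 0) (x y : A) (T : Module.End F A) :
    ad F A x * T * ad F A y ∈ innerDerivationAlgebra F A := by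
  obtain ⟨e, f, h, hdual⟩ := exists_isSymmetricSeparability_regularTrace_dual hn
  obtain ⟨n, a, b, hT⟩ := h.exists_apply_eq_sum_mul_mul hdual T
  have hT' : T = ∑ k, mulLeft F (a k) * mulRight F (b k) := by
    ext z
    simp only [hT, LinearMap.sum_apply, Module.End.mul_apply, LinearMap.mulLeft_apply,
      LinearMap.mulRight_apply, mul_assoc]
  rw [hT', Finset.mul_sum, Finset.sum_mul]
  exact sum_mem fun k _ => h.ad_mul_mulLeft_mul_mulRight_mul_ad_mem h2 x (a k) (b k) y

theorem mem_innerDerivationAlgebra_of_apply_mem (h2 : (2 : F) ≠ 0) {T : Module.End F A}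
    (h1 : T 1 = 0) (hT : ∀ x, T x ∈ commutatorSubspace F A) : T ∈ innerDerivationAlgebra F A := by
  obtain ⟨e, f, h, -⟩ := exists_isSymmetricSeparability_regularTrace_dual hn
  rw [h.eq_sum_ad_mul_mul_ad hn h1 fun x => regularTrace_eq_zero_of_mem_commutatorSubspace (hT x)]
  exact sum_mem fun i _ => sum_mem fun j _ => ad_mul_mul_ad_mem hn h2 _ _ _

end Characterization

theorem corollary3p6_general {F A : Type*} [Field F] [Ring A] [Algebra F A]
    [Algebra.IsCentral F A] [IsSimpleRing A] (h2 : (2 : F) ≠ 0)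
    (hn : (Module.finrank F A : F) ≠ 0) (T : Module.End F A) :
    List.TFAE
      [T ∈ innerDerivationAlgebra F A,
       ∃ (n : ℕ) (a b : Fin n → A), (∀ x : A, T x = ∑ k, a k * x * b k) ∧
         ∑ k, a k * b k = 0 ∧ ∑ k, b k * a k = 0,
       T 1 = 0 ∧ ∀ x : A, T x ∈ commutatorSubspace F A] := by
  have : FiniteDimensional F A :=
    Module.finite_of_finrank_pos (Nat.pos_of_ne_zero fun h => hn (by rw [h, Nat.cast_zero]))
  tfae_have 1 → 3 := apply_one_and_apply_mem_of_mem_innerDerivationAlgebra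
  tfae_have 2 → 3 := fun ⟨_, _, _, hT, hab, hba⟩ =>
    apply_one_and_apply_mem_of_apply_eq_sum hT hab hba
  tfae_have 3 → 1 := fun h => mem_innerDerivationAlgebra_of_apply_mem hn h2 h.1 h.2
  tfae_have 3 → 2 := fun h => exists_apply_eq_sum_of_apply_mem hn h.1 h.2
  tfae_finish

theorem corollary3p6 {F A : Type*} [Field F] [CharZero F] [Ring A] [Algebra F A]
    [FiniteDimensional F A] [Algebra.IsCentral F A] [IsSimpleRing A] (T : Module.End F A) :
    List.TFAE
      [T ∈ innerDerivationAlgebra F A,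
       ∃ (n : ℕ) (a b : Fin n → A), (∀ x : A, T x = ∑ k, a k * x * b k) ∧
         ∑ k, a k * b k = 0 ∧ ∑ k, b k * a k = 0,
       T 1 = 0 ∧ ∀ x : A, T x ∈ commutatorSubspace F A] :=
  corollary3p6_general two_ne_zero (Nat.cast_ne_zero.2 Module.finrank_pos.ne') T
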